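/- Let $F$ be a finite forest, i.e. a finite acyclic simple graph (possibly disconnected or empty), with vertex set $V$, and let $\mathrm{Ind}(F)$ be its independence complex: the simplicial complex on $V$ whose faces are the independent sets of vertices of $F$ (including $\emptyset$). Here a simplicial complex on a finite set $X$ is any family of subsets of $X$ closed under taking subsets; a vertex is a face with one element. Topological statements refer to the geometric realization, i.e. the union of the convex hulls of the faces in the real vector space with basis $X$; the realization of $\{\emptyset\}$ is empty and is regarded as the sphere $S^{-1}$, while the complex $\emptyset$ without any face is regarded as contractible. For $a\in X$ put $$(\Delta:a)=\{m\in\Delta : a\notin m,\ m\cup\{a\}\in\Delta\},\qquad (\Delta,a)=\{m\in\Delta : a\notin m\}.$$ The class of grapes is defined recursively (as the smallest class with these properties): $\Delta$ is a grape if it has at most one vertex, or if there is $a\in X$ such that $(\Delta:a)$ is contractible in $(\Delta,a)$ (that is, $(\Delta:a)=\emptyset$ or the inclusion of realizations is homotopic to a constant map) and both $(\Delta,a)$ and $(\Delta:a)$ are grapes. Let $\gamma(F)$ be the minimal cardinality of a dominating set of $F$ (a set $D\subseteq V$ such that every vertex is in $D$ or adjacent to a vertex of $D$), and $i(F)$ the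 minimal cardinality of an independent dominating set of $F$. Then $\mathrm{Ind}(F)$ is a grape. Moreover, either $\mathrm{Ind}(F)$ is contractible, or $i(F)=\gamma(F)$ and $\mathrm{Ind}(F)$ is homotopy equivalent to the sphere of dimension $i(F)-1=\gamma(F)-1$. -/

import Mathlib

/-- A simplicial complex on the set `X`: a family of (finite) subsets of `X`, closed under passing
to subsets. Neither `∅` nor the singletons are required to be faces, so the void complex (no face
at all) and the complex `{∅}` are different objects. -/
@[ext]
structure SimplComplex (X : Type*) where
  faces : Set (Finset X)
  down_closed : ∀ {σ τ : Finset X}, σ ∈ faces → τ ⊆ σ → τ ∈ faces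

namespace SimplComplex

variable {X : Type*} [DecidableEq X]

/-- The link `(Δ : σ)`. -/
def link (Δ : SimplComplex X) (σ : Finset X) : SimplComplex X where
  faces := {m | m ∈ Δ.faces ∧ σ ∩ m = ∅ ∧ m ∪ σ ∈ Δ.faces}
  down_closed := by
    rintro m m' ⟨h1, h2, h3⟩ h
    exact ⟨Δ.down_closed h1 h,
      Finset.subset_empty.mp (h2 ▸ Finset.inter_subset_inter_left h),
      Δ.down_closed h3 (Finset.union_subset_union_left h)⟩

/-- The face-deletion `(Δ , σ)`. -/
def deletion (Δ : SimplComplex X) (σ : Finset X) : SimplComplex X where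
  faces := {m | m ∈ Δ.faces ∧ ¬ σ ⊆ m}
  down_closed := by
    rintro m m' ⟨h1, h2⟩ h
    exact ⟨Δ.down_closed h1 h, fun h' => h2 (h'.trans h)⟩

/-- The standard geometric realization, in the real vector space `X → ℝ` (for finite `X`, the
space with basis `X`): the union of the convex hulls of the faces, each `x : X` being identified
with the corresponding basis vector. It is empty for `{∅}` and for the void complex. -/
def realization (Δ : SimplComplex X) : Set (X → ℝ) :=
  ⋃ σ ∈ Δ.faces, convexHull ℝ ((fun x : X => (Pi.single x 1 : X → ℝ)) '' (σ : Set X))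

theorem realization_mono {Γ Δ : SimplComplex X} (h : Γ.faces ⊆ Δ.faces) :
    Γ.realization ⊆ Δ.realization :=
  Set.biUnion_subset_biUnion_left h

/-- `Γ` is a subcomplex of `Δ` that is contractible in `Δ`: the inclusion of the realizations is
homotopic to a constant map. By convention the void complex is contractible. -/
def ContractibleIn (Γ Δ : SimplComplex X) : Prop :=
  ∃ h : Γ.faces ⊆ Δ.faces,
    Γ.faces = ∅ ∨ (ContinuousMap.inclusion (realization_mono h)).Nullhomotopic

/-- Grapes. The recursion is well-founded: the predicate is the least one with these closure
properties. -/
inductive IsGrape : SimplComplex X → Prop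
  | of_at_most_one_vertex (Δ : SimplComplex X)
      (h : ∀ x y : X, {x} ∈ Δ.faces → {y} ∈ Δ.faces → x = y) : IsGrape Δ
  | step (Δ : SimplComplex X) (a : X)
      (hcontr : ContractibleIn (Δ.link {a}) (Δ.deletion {a}))
      (hdel : IsGrape (Δ.deletion {a})) (hlink : IsGrape (Δ.link {a})) : IsGrape Δ

end SimplComplex

namespace SimpleGraph

variable {V : Type*}

/-- The independence complex `Ind(G)`: its faces are the independent sets of vertices. -/
def indComplex (G : SimpleGraph V) : SimplComplex V where
  faces := {σ | G.IsIndepSet (σ : Set V)}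
  down_closed := fun h hτ => Set.Pairwise.mono (Finset.coe_subset.mpr hτ) h

/-- The closed neighborhood `N[S]`. -/
def closedNbhd (G : SimpleGraph V) (S : Set V) : Set V :=
  {w | ∃ s ∈ S, G.Adj s w} ∪ S

/-- `D` is a dominating set: `N[D] = V`. -/
def IsDominatingSet (G : SimpleGraph V) (D : Set V) : Prop :=
  G.closedNbhd D = Set.univ

/-- The domination number `γ(G)` (of a finite graph). -/
noncomputable def domNumber (G : SimpleGraph V) : ℕ :=
  sInf {n | ∃ D : Finset V, G.IsDominatingSet (D : Set V) ∧ D.card = n}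

/-- The independent domination number `i(G)` (of a finite graph). -/
noncomputable def indepDomNumber (G : SimpleGraph V) : ℕ :=
  sInf {n | ∃ D : Finset V, G.IsIndepSet (D : Set V) ∧ G.IsDominatingSet (D : Set V) ∧ D.card = n}

end SimpleGraph

/-!
Deleting a vertex `b` whose neighbourhood contains the neighbourhood of another vertex does not
change the homotopy type of an independence complex (a strong collapse). If `w` is the neighbour
of a leaf `u`, all other neighbours of `w` can be deleted in this way, so a forest folds to a
graph with an isolated vertex, whose complex is a cone, or to an induced matching of `k` edges,
whose complex is the boundary of the `k`-dimensional cross-polytope. If the leaf is always chosen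
at the end of the forest, the vertices `w` form an independent dominating set of size `k`, while
the leaves, moved slightly, have `k` pairwise disjoint closed neighbourhoods, so that every
dominating set has at least `k` elements.
-/

theorem homotopic_of_segment_subset {Y E : Type*} [TopologicalSpace Y] [AddCommGroup E]
    [Module ℝ E] [TopologicalSpace E] [IsTopologicalAddGroup E] [ContinuousSMul ℝ E] {A : Set E}
    {f g : C(Y, A)} (h : ∀ y, segment ℝ (f y : E) (g y) ⊆ A) : f.Homotopic g := by
  let coe : C(A, E) := ⟨Subtype.val, continuous_subtype_val⟩
  let H := ContinuousMap.Homotopy.affine (coe.comp f) (coe.comp g)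
  have hmem : ∀ p, H p ∈ A := fun p =>
    h p.2 (segment_eq_image_lineMap ℝ (f p.2 : E) (g p.2) ▸ Set.mem_image_of_mem _ p.1.2)
  exact ⟨⟨⟨fun p => ⟨H p, hmem p⟩, by fun_prop⟩, fun y => Subtype.ext (H.map_zero_left y),
    fun y => Subtype.ext (H.map_one_left y)⟩⟩

theorem nonempty_sphere_homeomorph {E F : Type*} [NormedAddCommGroup E] [NormedSpace ℝ E]
    [NormedAddCommGroup F] [NormedSpace ℝ F] (e : E ≃L[ℝ] F) :
    Nonempty (Metric.sphere (0 : E) 1 ≃ₜ Metric.sphere (0 : F) 1) := by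
  let B : Set E := e ⁻¹' Metric.closedBall 0 1
  have hB : Convex ℝ B := (convex_closedBall (0 : F) 1).linear_preimage e.toLinearMap
  have hB₀ : (interior B).Nonempty :=
    ⟨0, mem_interior_iff_mem_nhds.2 (e.continuous.continuousAt.preimage_mem_nhds
      (by simpa using Metric.closedBall_mem_nhds (0 : F) one_pos))⟩
  have hB₁ : Bornology.IsBounded B := by
    have := e.symm.lipschitz.isBounded_image (Metric.isBounded_closedBall (x := (0 : F)) (r := 1))
    rwa [e.symm.image_eq_preimage_symm] at this
  obtain ⟨h, -, -, hh⟩ := exists_homeomorph_image_interior_closure_frontier_eq_unitBall hB hB₀ hB₁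
  have hfr : frontier B = e ⁻¹' Metric.sphere 0 1 := by
    rw [← e.coe_toHomeomorph, ← frontier_closedBall (0 : F) one_ne_zero]
    exact (e.toHomeomorph.preimage_frontier _).symm
  exact ⟨(h.sets (by rw [← hh, h.preimage_image])).symm.trans (e.toHomeomorph.sets hfr)⟩

namespace SimplComplex

variable {X : Type*} [DecidableEq X] {Δ Γ : SimplComplex X}

/-- The standard closed simplex spanned by the basis vectors of `X → ℝ` indexed by `σ`. -/
def closedSimplex (σ : Finset X) : Set (X → ℝ) :=
  convexHull ℝ ((fun x : X => (Pi.single x 1 : X → ℝ)) '' (σ : Set X))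

theorem mem_closedSimplex {σ : Finset X} {x : X → ℝ} :
    x ∈ closedSimplex σ ↔ (∀ i, 0 ≤ x i) ∧ (∀ i ∉ σ, x i = 0) ∧ ∑ i ∈ σ, x i = 1 := by
  constructor
  · let K : Set (X → ℝ) := {x | (∀ i, 0 ≤ x i) ∧ (∀ i ∉ σ, x i = 0) ∧ ∑ i ∈ σ, x i = 1}
    have hK : Convex ℝ K := by
      rintro x ⟨hx, hx', hx₁⟩ y ⟨hy, hy', hy₁⟩ s t hs ht hst
      refine ⟨fun i => ?_, fun i hi => ?_, ?_⟩
      · exact add_nonneg (mul_nonneg hs (hx i)) (mul_nonneg ht (hy i))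
      · simp [hx' i hi, hy' i hi]
      · simp [Finset.sum_add_distrib, ← Finset.mul_sum, hx₁, hy₁, hst]
    refine fun h => convexHull_min (t := K) ?_ hK h
    rintro - ⟨v, hv, rfl⟩
    have hnonneg : (0 : X → ℝ) ≤ Pi.single v 1 := Pi.single_nonneg.2 zero_le_one
    refine ⟨hnonneg, fun i hi => ?_, ?_⟩
    · exact Pi.single_eq_of_ne (ne_of_mem_of_not_mem hv hi).symm 1
    · simp [Finset.sum_pi_single', Finset.mem_coe.1 hv]
  · rintro ⟨hx, hx', hx₁⟩
    have hsum : ∑ i ∈ σ, x i • (Pi.single i 1 : X → ℝ) = x := by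
      funext j
      by_cases hj : j ∈ σ <;> simp [Finset.sum_apply, Pi.single_apply, hj, hx']
    rw [← hsum]
    exact (convex_convexHull ℝ _).sum_mem (fun i _ => hx i) hx₁
      fun i hi => subset_convexHull ℝ _ ⟨i, hi, rfl⟩

theorem mem_realization {x : X → ℝ} :
    x ∈ Δ.realization ↔ ∃ σ ∈ Δ.faces, x ∈ closedSimplex σ := by
  simp only [realization, closedSimplex, Set.mem_iUnion, exists_prop]

theorem closedSimplex_subset_realization {σ : Finset X} (hσ : σ ∈ Δ.faces) :
    closedSimplex σ ⊆ Δ.realization := fun _ hx => mem_realization.2 ⟨σ, hσ, hx⟩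

theorem closedSimplex_mono {σ τ : Finset X} (h : σ ⊆ τ) : closedSimplex σ ⊆ closedSimplex τ :=
  convexHull_mono (Set.image_mono (Finset.coe_subset.2 h))

theorem single_mem_closedSimplex {σ : Finset X} {u : X} (hu : u ∈ σ) :
    Pi.single u 1 ∈ closedSimplex σ :=
  subset_convexHull ℝ _ ⟨u, hu, rfl⟩

theorem contractibleSpace_realization_of_cone {u : X} (hΔ : Δ.faces.Nonempty)
    (hu : ∀ σ ∈ Δ.faces, insert u σ ∈ Δ.faces) : ContractibleSpace Δ.realization := by
  have hstar : StarConvex ℝ (Pi.single u 1) Δ.realization := fun x hx => by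
    obtain ⟨σ, hσ, hx⟩ := mem_realization.1 hx
    have hx' := closedSimplex_mono (Finset.subset_insert u σ) hx
    have hu' := single_mem_closedSimplex (Finset.mem_insert_self u σ)
    exact fun s t hs ht hst =>
      closedSimplex_subset_realization (hu σ hσ) (convex_convexHull ℝ _ hu' hx' hs ht hst)
  obtain ⟨σ, hσ⟩ := hΔ
  exact hstar.contractibleSpace ⟨_, closedSimplex_subset_realization (hu σ hσ)
    (single_mem_closedSimplex (Finset.mem_insert_self u σ))⟩

theorem ContractibleIn.of_contractibleSpace (h : Γ.faces ⊆ Δ.faces)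
    [ContractibleSpace Δ.realization] : ContractibleIn Γ Δ := by
  refine ⟨h, Or.inr ?_⟩
  have := (id_nullhomotopic Δ.realization).comp_left (ContinuousMap.inclusion (realization_mono h))
  rwa [ContinuousMap.id_comp] at this

/-- The linear map moving the mass at the vertex `v` to the vertex `u`: it carries the basis vector
of `v` to that of `u` and fixes the other basis vectors. -/
def pushVertex (v u : X) : (X → ℝ) →L[ℝ] (X → ℝ) :=
  ContinuousLinearMap.id ℝ (X → ℝ) +
    (ContinuousLinearMap.proj v).smulRight (Pi.single u 1 - Pi.single v 1)

theorem pushVertex_apply (v u : X) (x : X → ℝ) :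
    pushVertex v u x = x + x v • (Pi.single u 1 - Pi.single v 1) := rfl

theorem pushVertex_mem_closedSimplex (v u : X) {σ : Finset X} {x : X → ℝ}
    (hx : x ∈ closedSimplex σ) : pushVertex v u x ∈ closedSimplex (insert u (σ.erase v)) := by
  suffices h : closedSimplex σ ⊆ pushVertex v u ⁻¹' closedSimplex (insert u (σ.erase v)) from h hx
  refine convexHull_min ?_ ((convex_convexHull ℝ _).linear_preimage (pushVertex v u).toLinearMap)
  rintro - ⟨i, hi, rfl⟩
  obtain rfl | hiv := eq_or_ne i v
  · simpa [pushVertex_apply] using single_mem_closedSimplex (Finset.mem_insert_self u (σ.erase i))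
  · simpa [pushVertex_apply, Pi.single_eq_of_ne hiv.symm] using
      single_mem_closedSimplex (Finset.mem_insert_of_mem (Finset.mem_erase.2 ⟨hiv, hi⟩))

theorem pushVertex_of_mem_realization_deletion {v u : X} {x : X → ℝ}
    (hx : x ∈ (Δ.deletion {v}).realization) : pushVertex v u x = x := by
  obtain ⟨σ, ⟨-, hσ⟩, hx⟩ := mem_realization.1 hx
  have hxv : x v = 0 := (mem_closedSimplex.1 hx).2.1 v (by simpa using hσ)
  simp [pushVertex_apply, hxv]

/-- Strong collapse: pushing `v` to `u` is a homotopy inverse of the inclusion of the deletion. -/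
theorem nonempty_homotopyEquiv_deletion {v u : X} (huv : u ≠ v)
    (h : ∀ σ ∈ Δ.faces, v ∈ σ → insert u σ ∈ Δ.faces) :
    Nonempty (ContinuousMap.HomotopyEquiv Δ.realization (Δ.deletion {v}).realization) := by
  have hmem : ∀ x ∈ Δ.realization, pushVertex v u x ∈ (Δ.deletion {v}).realization ∧
      segment ℝ (pushVertex v u x) x ⊆ Δ.realization := fun x hx => by
    by_cases hxd : x ∈ (Δ.deletion {v}).realization
    · rw [pushVertex_of_mem_realization_deletion hxd, segment_same, Set.singleton_subset_iff]
      exact ⟨hxd, hx⟩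
    obtain ⟨σ, hσ, hxσ⟩ := mem_realization.1 hx
    have hvσ : v ∈ σ := by
      by_contra hv
      exact hxd (mem_realization.2 ⟨σ, ⟨hσ, by simpa using hv⟩, hxσ⟩)
    have hpush := pushVertex_mem_closedSimplex v u hxσ
    have hle : insert u (σ.erase v) ⊆ insert u σ :=
      Finset.insert_subset_insert u (Finset.erase_subset v σ)
    refine ⟨mem_realization.2 ⟨_, ⟨Δ.down_closed (h σ hσ hvσ) hle, ?_⟩, hpush⟩, ?_⟩
    · simp [huv.symm]
    · exact ((convex_convexHull ℝ _).segment_subset (closedSimplex_mono hle hpush)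
        (closedSimplex_mono (Finset.subset_insert u σ) hxσ)).trans
        (closedSimplex_subset_realization (h σ hσ hvσ))
  let r : C(Δ.realization, (Δ.deletion {v}).realization) :=
    ⟨fun x => ⟨pushVertex v u x, (hmem x x.2).1⟩, by fun_prop⟩
  let i : C((Δ.deletion {v}).realization, Δ.realization) :=
    ContinuousMap.inclusion (realization_mono fun _ hσ => hσ.1)
  have hri : r.comp i = ContinuousMap.id _ :=
    ContinuousMap.ext fun x => Subtype.ext (pushVertex_of_mem_realization_deletion x.2)
  exact ⟨⟨r, i, homotopic_of_segment_subset fun x => (hmem x x.2).2,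
    hri ▸ ContinuousMap.Homotopic.refl _⟩⟩

end SimplComplex

namespace IndependenceComplex

open SimplComplex

variable {V : Type*} {G : SimpleGraph V}

/-! ### Leaves at the end of a forest -/

theorem exists_neighborSet_subsingleton [Finite V] [Nonempty V] (hG : G.IsAcyclic) :
    ∃ x, (G.neighborSet x).Subsingleton := by
  classical
  obtain ⟨v⟩ := ‹Nonempty V›
  let c := G.connectedComponentMk v
  suffices h : ∃ x : c, (c.toSimpleGraph.neighborSet x).Subsingleton by
    obtain ⟨x, hx⟩ := h
    have hc : ∀ y, G.Adj x y → y ∈ c := fun y => c.mem_supp_of_adj_mem_supp x.2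
    exact ⟨x, fun y hy z hz => congrArg Subtype.val
      (@hx ⟨y, hc y hy⟩ hy ⟨z, hc z hz⟩ hz)⟩
  obtain hsub | hnt := subsingleton_or_nontrivial c
  · exact ⟨⟨v, rfl⟩, fun y _ z _ => Subsingleton.elim y z⟩
  · have : Fintype c := Fintype.ofFinite c
    obtain ⟨x, hx⟩ := (hG.isTree_connectedComponent c).exists_vert_degree_one_of_nontrivial
    obtain ⟨y, -, hy⟩ := SimpleGraph.degree_eq_one_iff_existsUnique_adj.1 hx
    exact ⟨x, fun z hz z' hz' => (hy z hz).trans (hy z' hz').symm⟩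

/-- `x` has at most one neighbour in `S`; thus isolated vertices count as leaves. -/
def IsLeafIn (G : SimpleGraph V) (S : Set V) (x : V) : Prop := (G.neighborSet x ∩ S).Subsingleton

theorem IsLeafIn.anti {S T : Set V} {x : V} (hx : IsLeafIn G T x) (h : S ⊆ T) : IsLeafIn G S x :=
  Set.Subsingleton.anti hx (Set.inter_subset_inter_right _ h)

theorem exists_isLeafIn (hG : G.IsAcyclic) {S : Set V} (hfin : S.Finite) (hS : S.Nonempty) :
    ∃ x ∈ S, IsLeafIn G S x := by
  have := hfin.to_subtype
  have := hS.to_subtype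
  obtain ⟨x, hx⟩ := exists_neighborSet_subsingleton (hG.induce S)
  exact ⟨x, x.2, fun y hy z hz => congrArg Subtype.val (@hx ⟨y, hy.2⟩ hy.1 ⟨z, hz.2⟩ hz.1)⟩

/-- `S` without its leaves. -/
def nonLeaves (G : SimpleGraph V) (S : Set V) : Set V := {x ∈ S | ¬ IsLeafIn G S x}

theorem nonLeaves_subset (S : Set V) : nonLeaves G S ⊆ S := Set.sep_subset _ _

theorem exists_adj_isLeafIn {S : Set V} {x : V} (hx : ¬ IsLeafIn G S x)
    (hx' : IsLeafIn G (nonLeaves G S) x) : ∃ y ∈ S, G.Adj x y ∧ IsLeafIn G S y := by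
  by_contra! h
  exact hx fun y hy z hz => hx' ⟨hy.1, hy.2, h y hy.2 hy.1⟩ ⟨hz.1, hz.2, h z hz.2 hz.1⟩

/-- The vertices of `S` that are neither leaves nor adjacent to a leaf. -/
def core (G : SimpleGraph V) (S : Set V) : Set V :=
  {x ∈ S | ¬ IsLeafIn G S x ∧ ∀ y ∈ S, G.Adj x y → ¬ IsLeafIn G S y}

theorem core_subset_nonLeaves_nonLeaves (S : Set V) :
    core G S ⊆ nonLeaves G (nonLeaves G S) := fun _ ⟨hx, hn, hadj⟩ =>
  ⟨⟨hx, hn⟩, fun h =>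
    let ⟨y, hy, hxy, hyl⟩ := exists_adj_isLeafIn hn h
    hadj y hy hxy hyl⟩

theorem exists_end_leaf (hG : G.IsAcyclic) {S : Set V} (hfin : S.Finite) (hS : S.Nonempty)
    (hiso : ∀ x ∈ S, ∃ y ∈ S, G.Adj x y) :
    ∃ u ∈ S, ∃ w ∈ S, G.Adj u w ∧ IsLeafIn G S u ∧
      ∀ v ∈ S, G.Adj w v → IsLeafIn G (core G S) v := by
  have hcore := core_subset_nonLeaves_nonLeaves (G := G) S
  have hsub : nonLeaves G (nonLeaves G S) ⊆ S := (nonLeaves_subset _).trans (nonLeaves_subset S)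
  obtain hempty | hne := (nonLeaves G (nonLeaves G S)).eq_empty_or_nonempty
  · obtain ⟨u, hu, hul⟩ := exists_isLeafIn hG hfin hS
    obtain ⟨w, hw, huw⟩ := hiso u hu
    refine ⟨u, hu, w, hw, huw, hul, fun v _ _ => ?_⟩
    have hcore₀ : core G S = ∅ := Set.subset_empty_iff.1 (hcore.trans hempty.subset)
    simp [IsLeafIn, hcore₀]
  obtain ⟨v, ⟨hv, hvn⟩, hvl⟩ := exists_isLeafIn hG (hfin.subset hsub) hne
  obtain ⟨w, ⟨hw, hwn⟩, hvw, hwl⟩ := exists_adj_isLeafIn hvn hvl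
  obtain ⟨u, hu, hwu, hul⟩ := exists_adj_isLeafIn hwn hwl
  refine ⟨u, hu, w, hw, hwu.symm, hul, fun v' hv' hwv' => ?_⟩
  by_cases hv'l : IsLeafIn G S v'
  · exact hv'l.anti (hcore.trans hsub)
  · obtain rfl := hwl ⟨hvw.symm, hv⟩ ⟨hwv', hv', hv'l⟩
    exact hvl.anti hcore

/-! ### Packings of closed neighbourhoods -/

/-- `z` dominates `x`: `x` lies in the closed neighbourhood of `z`. -/
def Dominates (G : SimpleGraph V) (z x : V) : Prop := z = x ∨ G.Adj z x

open Classical in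
/-- `S` without the closed neighbourhood of `w`. -/
noncomputable def removeNbhd (G : SimpleGraph V) (S : Finset V) (w : V) : Finset V :=
  {x ∈ S | ¬ Dominates G w x}

theorem mem_removeNbhd {S : Finset V} {w x : V} :
    x ∈ removeNbhd G S w ↔ x ∈ S ∧ ¬ Dominates G w x := by
  simp [removeNbhd]

theorem removeNbhd_ssubset {S : Finset V} {w : V} (hw : w ∈ S) : removeNbhd G S w ⊂ S := by
  classical exact Finset.filter_ssubset.2 ⟨w, hw, not_not.2 (Or.inl rfl)⟩

/-- The graph induced on `S` has an isolated vertex. -/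
def HasIsolated (G : SimpleGraph V) (S : Finset V) : Prop :=
  ∃ u ∈ S, ∀ x ∈ S, ¬ G.Adj u x

theorem isDominatingSet_iff {D : Finset V} :
    G.IsDominatingSet (D : Set V) ↔ ∀ x, ∃ z ∈ D, Dominates G z x := by
  rw [SimpleGraph.IsDominatingSet, Set.eq_univ_iff_forall]
  refine forall_congr' fun x => ?_
  simp only [SimpleGraph.closedNbhd, Dominates, Set.mem_union, Set.mem_ofPred_eq, Finset.mem_coe]
  grind

/-- The vertices `p i` of `S` have pairwise disjoint closed neighbourhoods in `S`. -/
structure IsPacking {ι : Type*} (G : SimpleGraph V) (S : Finset V) (p : ι → V) : Prop where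
  mem : ∀ i, p i ∈ S
  eq_of_dominates : ∀ i j, ∀ z ∈ S, Dominates G z (p i) → Dominates G z (p j) → i = j

theorem IsPacking.le_card [Fintype V] {k : ℕ} {p : Fin k → V}
    (hp : IsPacking G Finset.univ p) {D : Finset V} (hD : G.IsDominatingSet (D : Set V)) :
    k ≤ D.card := by
  choose z hz hzp using fun i => isDominatingSet_iff.1 hD (p i)
  have hinj : Function.Injective z := fun i j hij =>
    hp.eq_of_dominates i j (z i) (Finset.mem_univ _) (hzp i) (hij ▸ hzp j)
  simpa using Finset.card_le_card_of_injOn (s := Finset.univ) z (fun i _ => hz i) hinj.injOn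

section EndLeaf

variable {S : Finset V} {w : V}

-- A leaf of `S` next to `x` serves as `x'` if there is one, and `x` itself otherwise.
theorem exists_forall_dominates_imp (hw : w ∈ S) (hiso : ¬ HasIsolated G (removeNbhd G S w)) {x : V}
    (hx : x ∈ removeNbhd G S w) :
    ∃ x' ∈ S, ∀ z ∈ S, Dominates G z x' →
      (z ∈ removeNbhd G S w ∧ Dominates G z x) ∨
      (z ∉ removeNbhd G S w ∧ G.Adj w z ∧ G.Adj z x ∧ x ∈ core G (S : Set V)) := by
  obtain ⟨hxS, hwx⟩ := mem_removeNbhd.1 hx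
  by_cases hleaf : ∃ y ∈ S, G.Adj x y ∧ IsLeafIn G (S : Set V) y
  · obtain ⟨y, hy, hxy, hyl⟩ := hleaf
    have hyT : y ∈ removeNbhd G S w := mem_removeNbhd.2 ⟨hy, by
      rintro (rfl | hwy)
      · exact hwx (Or.inr hxy.symm)
      · exact hwx (Or.inl (hyl ⟨hwy.symm, hw⟩ ⟨hxy.symm, hxS⟩))⟩
    refine ⟨y, hy, fun z hz hzy => Or.inl ?_⟩
    obtain rfl | hzy := hzy
    · exact ⟨hyT, Or.inr hxy.symm⟩
    · obtain rfl := hyl ⟨hzy.symm, hz⟩ ⟨hxy.symm, hxS⟩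
      exact ⟨hx, Or.inl rfl⟩
  · push Not at hleaf
    refine ⟨x, hxS, fun z hz hzx => ?_⟩
    by_cases hzT : z ∈ removeNbhd G S w
    · exact Or.inl ⟨hzT, hzx⟩
    have hzx : G.Adj z x := hzx.resolve_left fun h => hzT (h ▸ hx)
    have hwz : Dominates G w z := by
      by_contra h
      exact hzT (mem_removeNbhd.2 ⟨hz, h⟩)
    refine Or.inr ⟨hzT, hwz.resolve_left fun h => hwx (Or.inr (h ▸ hzx)), hzx, hxS, fun hxl => ?_,
      hleaf⟩
    refine hiso ⟨x, hx, fun y hy hxy => hzT ?_⟩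
    exact hxl ⟨hxy, (mem_removeNbhd.1 hy).1⟩ ⟨hzx.symm, hz⟩ ▸ hy

theorem IsPacking.exists_cons {k : ℕ} {p : Fin k → V} (hp : IsPacking G (removeNbhd G S w) p)
    {u : V} (hu : u ∈ S) (hw : w ∈ S) (huw : G.Adj u w) (hul : IsLeafIn G (S : Set V) u)
    (hend : ∀ v ∈ S, G.Adj w v → IsLeafIn G (core G (S : Set V)) v)
    (hiso : ¬ HasIsolated G (removeNbhd G S w)) :
    ∃ p' : Fin (k + 1) → V, IsPacking G S p' := by
  choose q hqS hq using fun i => exists_forall_dominates_imp hw hiso (hp.mem i)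
  have hwu : ∀ z ∈ S, Dominates G z u → z = u ∨ z = w := fun z hz =>
    Or.imp_right fun hzu => hul ⟨hzu.symm, hz⟩ ⟨huw, hw⟩
  have hcross : ∀ z ∈ S, Dominates G z u → ∀ j, ¬ Dominates G z (q j) := by
    intro z hz hzu j hzq
    have hpw : p j ≠ w := fun h => (mem_removeNbhd.1 (hp.mem j)).2 (Or.inl h.symm)
    have hzT : z ∉ removeNbhd G S w := fun hzT => (mem_removeNbhd.1 hzT).2
      ((hwu z hz hzu).elim (fun h => h ▸ Or.inr huw.symm) fun h => Or.inl h.symm)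
    obtain ⟨hzT', -⟩ | ⟨-, hwz, hzp, -⟩ := hq j z hz hzq
    · exact hzT hzT'
    obtain rfl | rfl := hwu z hz hzu
    · exact hpw (hul ⟨hzp, (mem_removeNbhd.1 (hp.mem j)).1⟩ ⟨huw, hw⟩)
    · exact hwz.ne rfl
  have hqq : ∀ i j, ∀ z ∈ S, Dominates G z (q i) → Dominates G z (q j) → i = j := by
    intro i j z hz hi hj
    obtain ⟨hzT, hi⟩ | ⟨hzT, hwz, hzi, hic⟩ := hq i z hz hi <;>
      obtain ⟨hzT', hj⟩ | ⟨hzT', -, hzj, hjc⟩ := hq j z hz hj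
    · exact hp.eq_of_dominates i j z hzT hi hj
    · exact absurd hzT hzT'
    · exact absurd hzT' hzT
    · exact hp.eq_of_dominates i j (p i) (hp.mem i) (Or.inl rfl)
        (Or.inl (hend z hz hwz ⟨hzi, hic⟩ ⟨hzj, hjc⟩))
  refine ⟨Fin.cons u q, Fin.cases hu hqS, Fin.cases (Fin.cases ?_ ?_) fun i => Fin.cases ?_ ?_⟩
  · exact fun _ _ _ _ => rfl
  · exact fun j z hz hzu hzq => absurd hzq (hcross z hz hzu j)
  · exact fun z hz hzq hzu => absurd hzq (hcross z hz hzu i)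
  · exact fun j z hz hi hj => congrArg Fin.succ (hqq i j z hz hi hj)

end EndLeaf

/-! ### Folding independence complexes -/

/-- The independence complex of the subgraph induced on `S`, as a complex on all vertices. -/
def indOn (G : SimpleGraph V) (S : Finset V) : SimplComplex V where
  faces := {σ | σ ⊆ S ∧ G.IsIndepSet (σ : Set V)}
  down_closed := fun hσ hτ => ⟨hτ.trans hσ.1, hσ.2.mono (Finset.coe_subset.2 hτ)⟩

theorem indOn_univ [Fintype V] (G : SimpleGraph V) : indOn G Finset.univ = G.indComplex := by
  ext σ
  simp [indOn, SimpleGraph.indComplex]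

theorem indOn_faces_mono {S T : Finset V} (h : S ⊆ T) : (indOn G S).faces ⊆ (indOn G T).faces :=
  fun _ hσ => ⟨hσ.1.trans h, hσ.2⟩

section Folding

variable [DecidableEq V]

theorem removeNbhd_subset_erase (G : SimpleGraph V) (S : Finset V) (w : V) :
    removeNbhd G S w ⊆ S.erase w := fun x hx => by
  rw [mem_removeNbhd] at hx
  exact Finset.mem_erase.2 ⟨fun h => hx.2 (Or.inl h.symm), hx.1⟩

theorem deletion_indOn (G : SimpleGraph V) (S : Finset V) (a : V) :
    (indOn G S).deletion {a} = indOn G (S.erase a) := by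
  ext σ
  simp only [deletion, indOn, Set.mem_ofPred_eq, Finset.singleton_subset_iff, Finset.subset_erase]
  tauto

theorem insert_mem_indOn {S σ : Finset V} {u : V} (hu : u ∈ S) (hσ : σ ∈ (indOn G S).faces) :
    insert u σ ∈ (indOn G S).faces ↔ ∀ x ∈ σ, ¬ G.Adj u x := by
  refine ⟨fun h x hx hux => ?_, fun h => ⟨Finset.insert_subset hu hσ.1, ?_⟩⟩
  · exact h.2 (by simp) (by simp [hx]) hux.ne hux
  · rw [Finset.coe_insert]
    exact hσ.2.insert fun x hx _ => ⟨h x hx, fun hxu => h x hx hxu.symm⟩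

theorem link_indOn {S : Finset V} {a : V} (ha : a ∈ S) :
    (indOn G S).link {a} = indOn G (removeNbhd G S a) := by
  ext σ
  have hdisj : {a} ∩ σ = ∅ ↔ ∀ x ∈ σ, a ≠ x := by
    rw [← Finset.disjoint_iff_inter_eq_empty, Finset.disjoint_singleton_left]
    exact ⟨fun h x hx hax => h (hax ▸ hx), fun h ha => h a ha rfl⟩
  change σ ∈ (indOn G S).faces ∧ {a} ∩ σ = ∅ ∧ σ ∪ {a} ∈ (indOn G S).faces ↔ _
  rw [hdisj, Finset.union_comm, ← Finset.insert_eq]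
  constructor
  · rintro ⟨hσ, hne, hins⟩
    have hadj := (insert_mem_indOn ha hσ).1 hins
    exact ⟨fun x hx => mem_removeNbhd.2 ⟨hσ.1 hx, not_or.2 ⟨hne x hx, hadj x hx⟩⟩, hσ.2⟩
  · rintro ⟨hσT, hσ⟩
    have h : ∀ x ∈ σ, x ∈ S ∧ ¬ Dominates G a x := fun x hx => mem_removeNbhd.1 (hσT hx)
    have hσS : σ ∈ (indOn G S).faces := ⟨fun x hx => (h x hx).1, hσ⟩
    exact ⟨hσS, fun x hx => (not_or.1 (h x hx).2).1,
      (insert_mem_indOn ha hσS).2 fun x hx => (not_or.1 (h x hx).2).2⟩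

theorem contractibleSpace_realization_of_hasIsolated {S : Finset V} (h : HasIsolated G S) :
    ContractibleSpace (indOn G S).realization := by
  obtain ⟨u, hu, hiso⟩ := h
  exact contractibleSpace_realization_of_cone ⟨∅, by simp [indOn, SimpleGraph.IsIndepSet]⟩
    fun σ hσ => (insert_mem_indOn hu hσ).2 fun x hx => hiso x (hσ.1 hx)

/-- One folding step: `S'` is `S` without a vertex `b` whose neighbourhood in `S` contains that of
another vertex `a`. -/
def FoldStep (G : SimpleGraph V) (S S' : Finset V) : Prop :=
  ∃ a ∈ S, ∃ b ∈ S, a ≠ b ∧ (∀ x ∈ S, G.Adj a x → G.Adj b x) ∧ S' = S.erase b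

/-- `S` can be turned into `S'` by successive folding steps. -/
abbrev Folds (G : SimpleGraph V) : Finset V → Finset V → Prop :=
  Relation.ReflTransGen (FoldStep G)

theorem FoldStep.nonempty_homotopyEquiv {S S' : Finset V} (h : FoldStep G S S') :
    Nonempty (ContinuousMap.HomotopyEquiv (indOn G S).realization (indOn G S').realization) := by
  obtain ⟨a, ha, b, -, hab, hN, rfl⟩ := h
  rw [← deletion_indOn]
  refine nonempty_homotopyEquiv_deletion hab fun σ hσ hbσ =>
    (insert_mem_indOn ha hσ).2 fun x hx hax => ?_
  have hbx := hN x (hσ.1 hx) hax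
  exact hσ.2 hbσ hx hbx.ne hbx

theorem Folds.nonempty_homotopyEquiv {S S' : Finset V} (h : Folds G S S') :
    Nonempty (ContinuousMap.HomotopyEquiv (indOn G S).realization (indOn G S').realization) := by
  induction h with
  | refl => exact ⟨ContinuousMap.HomotopyEquiv.refl _⟩
  | tail _ hstep ih =>
    obtain ⟨e⟩ := ih
    obtain ⟨e'⟩ := hstep.nonempty_homotopyEquiv
    exact ⟨e.trans e'⟩

theorem FoldStep.subset {S S' : Finset V} (h : FoldStep G S S') : S' ⊆ S := by
  obtain ⟨-, -, b, -, -, -, rfl⟩ := h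
  exact Finset.erase_subset b S

theorem Folds.subset {S S' : Finset V} (h : Folds G S S') : S' ⊆ S := by
  induction h with
  | refl => exact Finset.Subset.refl S
  | tail _ hstep ih => exact hstep.subset.trans ih

theorem Folds.contractibleSpace {S T : Finset V} (h : Folds G S T) (hT : HasIsolated G T) :
    ContractibleSpace (indOn G S).realization := by
  obtain ⟨e⟩ := h.nonempty_homotopyEquiv
  have := contractibleSpace_realization_of_hasIsolated hT
  exact e.contractibleSpace

theorem folds_sdiff {S B : Finset V} {u : V} (hu : u ∈ S) (hB : B ⊆ S.erase u)
    (hN : ∀ b ∈ B, ∀ x ∈ S, G.Adj u x → G.Adj b x) : Folds G S (S \ B) := by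
  induction B using Finset.induction_on with
  | empty => rw [Finset.sdiff_empty]
  | insert b B hb ih =>
    rw [Finset.insert_subset_iff, Finset.mem_erase] at hB
    have hu' : u ∉ B := fun h => Finset.notMem_erase u S (hB.2 h)
    refine (ih hB.2 fun b' hb' => hN b' (Finset.mem_insert_of_mem hb')).tail
      ⟨u, ?_, b, ?_, hB.1.1.symm, fun x hx => ?_, Finset.sdiff_insert _ _ _⟩
    · exact Finset.mem_sdiff.2 ⟨hu, hu'⟩
    · exact Finset.mem_sdiff.2 ⟨hB.1.2, hb⟩
    · exact hN b (Finset.mem_insert_self b B) x (Finset.mem_sdiff.1 hx).1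

theorem FoldStep.union_left {R S S' : Finset V} (h : FoldStep G S S')
    (hR : ∀ r ∈ R, ∀ x ∈ S, ¬ Dominates G r x) : FoldStep G (R ∪ S) (R ∪ S') := by
  obtain ⟨a, ha, b, hb, hab, hN, rfl⟩ := h
  refine ⟨a, Finset.mem_union_right R ha, b, Finset.mem_union_right R hb, hab, fun x hx hax => ?_,
    ?_⟩
  · obtain hxR | hxS := Finset.mem_union.1 hx
    · exact absurd (Or.inr hax.symm) (hR x hxR a ha)
    · exact hN x hxS hax
  · have hbR : b ∉ R := fun hbR => hR b hbR b hb (Or.inl rfl)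
    rw [Finset.erase_union_distrib, Finset.erase_eq_of_notMem hbR]

theorem Folds.union_left {R S S' : Finset V} (h : Folds G S S')
    (hR : ∀ r ∈ R, ∀ x ∈ S, ¬ Dominates G r x) : Folds G (R ∪ S) (R ∪ S') := by
  induction h with
  | refl => exact Relation.ReflTransGen.refl
  | tail hfolds hstep ih =>
    exact ih.tail (hstep.union_left fun r hr x hx => hR r hr x (Folds.subset hfolds hx))

theorem folds_of_isLeafIn {S : Finset V} {u w : V} (hu : u ∈ S) (hw : w ∈ S)
    (huw : G.Adj u w) (hul : IsLeafIn G (S : Set V) u) :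
    Folds G S ({w, u} ∪ removeNbhd G S w) := by
  classical
  have h := folds_sdiff (B := {b ∈ S.erase u | G.Adj w b}) hu (Finset.filter_subset _ _)
    fun b hb x hx hux => hul ⟨huw, hw⟩ ⟨hux, hx⟩ ▸ (Finset.mem_filter.1 hb).2.symm
  convert h using 1
  ext x
  simp only [Finset.mem_union, Finset.mem_insert, Finset.mem_singleton, mem_removeNbhd, Dominates,
    Finset.mem_sdiff, Finset.mem_filter, Finset.mem_erase]
  grind [SimpleGraph.irrefl, SimpleGraph.Adj.symm]

theorem not_dominates_of_mem_removeNbhd {S : Finset V} {u w : V} (hw : w ∈ S) (huw : G.Adj u w)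
    (hul : IsLeafIn G (S : Set V) u) :
    ∀ r ∈ ({w, u} : Finset V), ∀ x ∈ removeNbhd G S w, ¬ Dominates G r x := by
  intro r hr x hx hrx
  obtain ⟨hxS, hwx⟩ := mem_removeNbhd.1 hx
  obtain rfl | rfl : r = w ∨ r = u := by simpa using hr
  · exact hwx hrx
  · obtain rfl | hrx := hrx
    · exact hwx (Or.inr huw.symm)
    · exact hwx (Or.inl (hul ⟨huw, hw⟩ ⟨hrx, hxS⟩))

theorem HasIsolated.union_left {R S : Finset V} (h : HasIsolated G S)
    (hR : ∀ r ∈ R, ∀ x ∈ S, ¬ Dominates G r x) : HasIsolated G (R ∪ S) := by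
  obtain ⟨u, hu, hiso⟩ := h
  refine ⟨u, Finset.mem_union_right R hu, fun x hx hux => ?_⟩
  obtain hxR | hxS := Finset.mem_union.1 hx
  · exact hR x hxR u hu (Or.inr hux.symm)
  · exact hiso x hxS hux

theorem exists_hasIsolated_erase (hG : G.IsAcyclic) {S : Finset V} (hS : 1 < S.card) :
    ∃ a ∈ S, HasIsolated G (S.erase a) := by
  by_cases hiso : HasIsolated G S
  · obtain ⟨u, hu, h⟩ := hiso
    obtain ⟨a, ha, hau⟩ := Finset.exists_mem_ne hS u
    exact ⟨a, ha, u, Finset.mem_erase.2 ⟨hau.symm, hu⟩,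
      fun x hx => h x (Finset.mem_of_mem_erase hx)⟩
  · obtain ⟨u, hu, hul⟩ := exists_isLeafIn hG S.finite_toSet (Finset.card_pos.1 (by omega))
    obtain ⟨w, hw, huw⟩ : ∃ w ∈ S, G.Adj u w := by
      by_contra! h
      exact hiso ⟨u, hu, h⟩
    refine ⟨w, hw, u, Finset.mem_erase.2 ⟨huw.ne, hu⟩, fun x hx hux => ?_⟩
    exact (Finset.mem_erase.1 hx).1 (hul ⟨hux, (Finset.mem_erase.1 hx).2⟩ ⟨huw, hw⟩)

theorem isGrape_indOn (hG : G.IsAcyclic) (S : Finset V) : (indOn G S).IsGrape := by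
  induction S using Finset.strongInduction with
  | H S ih =>
    obtain hS | hS := le_or_gt S.card 1
    · refine IsGrape.of_at_most_one_vertex _ fun x y hx hy => ?_
      exact Finset.card_le_one.1 hS x (hx.1 (by simp)) y (hy.1 (by simp))
    obtain ⟨a, ha, hiso⟩ := exists_hasIsolated_erase hG hS
    have := contractibleSpace_realization_of_hasIsolated hiso
    refine IsGrape.step _ a ?_ ?_ ?_ <;> simp only [link_indOn ha, deletion_indOn]
    · exact .of_contractibleSpace (indOn_faces_mono (removeNbhd_subset_erase G S a))
    · exact ih _ (Finset.erase_ssubset ha)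
    · exact ih _ (removeNbhd_ssubset ha)

end Folding

/-! ### Induced matchings and cross-polytopes -/

/-- The edges `a i — b i` form an induced matching of `G` with vertex set `T`. -/
structure IsInducedMatching {ι : Type*} (G : SimpleGraph V) (T : Finset V) (a b : ι → V) :
    Prop where
  mem_iff : ∀ v, v ∈ T ↔ ∃ i, v = a i ∨ v = b i
  adj_iff : ∀ i j, G.Adj (a i) (b j) ↔ i = j
  not_adj_left : ∀ i j, ¬ G.Adj (a i) (a j)
  not_adj_right : ∀ i j, ¬ G.Adj (b i) (b j)

namespace IsInducedMatching

variable {ι : Type*} {T : Finset V} {a b : ι → V}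

theorem left_injective (h : IsInducedMatching G T a b) : Function.Injective a :=
  fun i j hij => (h.adj_iff i j).1 (hij ▸ (h.adj_iff j j).2 rfl)

theorem right_injective (h : IsInducedMatching G T a b) : Function.Injective b :=
  fun i j hij => (h.adj_iff i j).1 (hij ▸ (h.adj_iff i i).2 rfl)

theorem left_ne_right (h : IsInducedMatching G T a b) (i j : ι) : a i ≠ b j :=
  fun hij => h.not_adj_left j i (hij ▸ (h.adj_iff j j).2 rfl)

theorem sum_eq [Fintype ι] {M : Type*} [AddCommMonoid M] (h : IsInducedMatching G T a b)
    (F : V → M) : ∑ v ∈ T, F v = ∑ i, (F (a i) + F (b i)) := by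
  classical
  have hT : T = Finset.univ.image (Sum.elim a b) := by
    ext v
    simp [h.mem_iff, exists_or, eq_comm]
  rw [hT, Finset.sum_image (h.left_injective.sumElim h.right_injective h.left_ne_right).injOn,
    Fintype.sum_sum_type, Finset.sum_add_distrib]
  rfl

variable [DecidableEq V]

theorem cons {k : ℕ} {a b : Fin k → V} (h : IsInducedMatching G T a b) {u w : V}
    (huw : G.Adj u w) (hT : ∀ r ∈ ({w, u} : Finset V), ∀ x ∈ T, ¬ Dominates G r x) :
    IsInducedMatching G ({w, u} ∪ T) (Fin.cons w a : Fin (k + 1) → V) (Fin.cons u b) := by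
  have ha : ∀ i, a i ∈ T := fun i => (h.mem_iff _).2 ⟨i, Or.inl rfl⟩
  have hb : ∀ i, b i ∈ T := fun i => (h.mem_iff _).2 ⟨i, Or.inr rfl⟩
  have hw : ∀ x ∈ T, ¬ G.Adj w x := fun x hx hwx => hT w (by simp) x hx (Or.inr hwx)
  have hu : ∀ x ∈ T, ¬ G.Adj u x := fun x hx hux => hT u (by simp) x hx (Or.inr hux)
  refine ⟨fun v => ?_, ?_, ?_, ?_⟩
  · simp [Fin.exists_fin_succ, h.mem_iff, or_assoc]
  all_goals
    simp only [Fin.forall_fin_succ, Fin.cons_zero, Fin.cons_succ]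
  · simp [huw.symm, hw _ (hb _), G.adj_comm _ u, hu _ (ha _), h.adj_iff, Fin.succ_inj,
      (Fin.succ_ne_zero _).symm]
  · simp [hw _ (ha _), G.adj_comm _ w, h.not_adj_left]
  · simp [hu _ (hb _), G.adj_comm _ u, h.not_adj_right]

end IsInducedMatching

variable [DecidableEq V]

theorem mem_realization_indOn {S : Finset V} {x : V → ℝ} :
    x ∈ (indOn G S).realization ↔ (∀ v, 0 ≤ x v) ∧ (∀ v ∉ S, x v = 0) ∧ ∑ v ∈ S, x v = 1 ∧
      ∀ v w, G.Adj v w → x v = 0 ∨ x w = 0 := by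
  simp only [mem_realization, mem_closedSimplex]
  constructor
  · rintro ⟨σ, hσ, hx, hx', hx₁⟩
    refine ⟨hx, fun v hv => hx' v fun hvσ => hv (hσ.1 hvσ), ?_, fun v w hvw => ?_⟩
    · rw [← hx₁, Finset.sum_subset hσ.1 fun v _ hv => hx' v hv]
    · by_contra! h
      exact hσ.2 (by_contra fun hv => h.1 (hx' v hv)) (by_contra fun hw => h.2 (hx' w hw))
        hvw.ne hvw
  · rintro ⟨hx, hx', hx₁, hadj⟩
    refine ⟨{v ∈ S | x v ≠ 0}, ⟨Finset.filter_subset _ _, fun v hv w hw _ hvw => ?_⟩, hx,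
      fun v hv => ?_, by rw [Finset.sum_filter_ne_zero, hx₁]⟩
    · exact (hadj v w hvw).elim (Finset.mem_filter.1 hv).2 (Finset.mem_filter.1 hw).2
    · by_contra h
      exact hv (Finset.mem_filter.2 ⟨by_contra fun hvS => h (hx' v hvS), h⟩)

/-- The point of the realization of a cross-polytope with opposite vertices `a i`, `b i`
corresponding to `y`: positive coordinates are put on the `a i`, negative ones on the `b i`. -/
noncomputable def crossPoint {ι : Type*} [Fintype ι] (a b : ι → V) (y : ι → ℝ) : V → ℝ :=
  ∑ i, ((y i)⁺ • Pi.single (a i) 1 + (y i)⁻ • Pi.single (b i) 1)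

namespace IsInducedMatching

variable {ι : Type*} {T : Finset V} {a b : ι → V}

theorem posPart_negPart_sub_of_mem_realization (h : IsInducedMatching G T a b) {x : V → ℝ}
    (hx : x ∈ (indOn G T).realization) (i : ι) :
    (x (a i) - x (b i))⁺ = x (a i) ∧ (x (a i) - x (b i))⁻ = x (b i) := by
  obtain ⟨hx, -, -, hadj⟩ := mem_realization_indOn.1 hx
  obtain h0 | h0 := hadj _ _ ((h.adj_iff i i).2 rfl)
  · simp [h0, hx]
  · simp [h0, hx]

variable [Fintype ι]

theorem crossPoint_left (h : IsInducedMatching G T a b) (y : ι → ℝ) (i : ι) :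
    crossPoint a b y (a i) = (y i)⁺ := by
  classical
  simp [crossPoint, Pi.single_apply, h.left_injective.eq_iff, h.left_ne_right]

theorem crossPoint_right (h : IsInducedMatching G T a b) (y : ι → ℝ) (i : ι) :
    crossPoint a b y (b i) = (y i)⁻ := by
  classical
  simp [crossPoint, Pi.single_apply, h.right_injective.eq_iff, (h.left_ne_right _ _).symm]

theorem crossPoint_of_notMem (h : IsInducedMatching G T a b) (y : ι → ℝ) {v : V} (hv : v ∉ T) :
    crossPoint a b y v = 0 := by
  simp only [h.mem_iff, not_exists, not_or] at hv
  simp [crossPoint, hv]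

theorem crossPoint_mem_realization (h : IsInducedMatching G T a b) {y : ι → ℝ}
    (hy : ∑ i, |y i| = 1) : crossPoint a b y ∈ (indOn G T).realization := by
  have hmem : ∀ v, crossPoint a b y v ≠ 0 → ∃ i, v = a i ∨ v = b i := fun v hv =>
    (h.mem_iff v).1 (by_contra fun hvT => hv (h.crossPoint_of_notMem y hvT))
  refine mem_realization_indOn.2 ⟨fun v => ?_, fun v => h.crossPoint_of_notMem y, ?_,
    fun v w hvw => ?_⟩
  · by_cases hv : crossPoint a b y v = 0
    · exact hv.ge
    obtain ⟨i, rfl | rfl⟩ := hmem v hv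
    · exact h.crossPoint_left y i ▸ posPart_nonneg (y i)
    · exact h.crossPoint_right y i ▸ negPart_nonneg (y i)
  · simp only [h.sum_eq, h.crossPoint_left, h.crossPoint_right, posPart_add_negPart, hy]
  · by_contra! hne
    have hpart : ∀ t : ℝ, t⁺ = 0 ∨ t⁻ = 0 := fun t =>
      (le_total t 0).imp posPart_eq_zero.2 negPart_eq_zero.2
    obtain ⟨i, rfl | rfl⟩ := hmem v hne.1 <;> obtain ⟨j, rfl | rfl⟩ := hmem w hne.2
    · exact h.not_adj_left i j hvw
    · obtain rfl := (h.adj_iff i j).1 hvw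
      rw [h.crossPoint_left, h.crossPoint_right] at hne
      exact (hpart (y i)).elim hne.1 hne.2
    · obtain rfl := (h.adj_iff j i).1 hvw.symm
      rw [h.crossPoint_left, h.crossPoint_right] at hne
      exact (hpart (y j)).elim hne.2 hne.1
    · exact h.not_adj_right i j hvw

theorem sum_abs_sub (h : IsInducedMatching G T a b) {x : V → ℝ}
    (hx : x ∈ (indOn G T).realization) : ∑ i, |x (a i) - x (b i)| = 1 := by
  have hparts := h.posPart_negPart_sub_of_mem_realization hx
  rw [← (mem_realization_indOn.1 hx).2.2.1, h.sum_eq]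
  refine Finset.sum_congr rfl fun i _ => ?_
  rw [← posPart_add_negPart, (hparts i).1, (hparts i).2]

theorem crossPoint_sub (h : IsInducedMatching G T a b) {x : V → ℝ}
    (hx : x ∈ (indOn G T).realization) : crossPoint a b (fun i => x (a i) - x (b i)) = x := by
  have hparts := h.posPart_negPart_sub_of_mem_realization hx
  funext v
  by_cases hv : v ∈ T
  · obtain ⟨i, rfl | rfl⟩ := (h.mem_iff v).1 hv
    · rw [h.crossPoint_left, (hparts i).1]
    · rw [h.crossPoint_right, (hparts i).2]
  · rw [h.crossPoint_of_notMem _ hv, (mem_realization_indOn.1 hx).2.1 v hv]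

/-- The independence complex of `k` disjoint edges is the boundary of the `k`-dimensional
cross-polytope, i.e. the unit sphere of the `ℓ¹` norm. -/
noncomputable def realizationHomeomorph (h : IsInducedMatching G T a b) :
    (indOn G T).realization ≃ₜ Metric.sphere (0 : PiLp 1 fun _ : ι => ℝ) 1 where
  toFun x := ⟨WithLp.toLp 1 fun i => x.1 (a i) - x.1 (b i), by
    simpa [PiLp.norm_eq_of_L1] using h.sum_abs_sub x.2⟩
  invFun y := ⟨crossPoint a b y.1, h.crossPoint_mem_realization (by
    have hy := mem_sphere_zero_iff_norm.1 y.2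
    rwa [PiLp.norm_eq_of_L1] at hy)⟩
  left_inv x := Subtype.ext (h.crossPoint_sub x.2)
  right_inv y := Subtype.ext <| PiLp.ext fun i => by
    simp [h.crossPoint_left, h.crossPoint_right]
  continuous_toFun := by
    have hcoord (v : V) : Continuous fun x : (indOn G T).realization => x.1 v :=
      (continuous_apply v).comp continuous_subtype_val
    exact ((PiLp.continuous_toLp 1 _).comp
      (continuous_pi fun i => (hcoord (a i)).sub (hcoord (b i)))).subtype_mk _
  continuous_invFun := by
    have := continuous_posPart (α := ℝ)
    have := continuous_negPart (α := ℝ)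
    unfold crossPoint
    fun_prop

theorem nonempty_homeomorph_sphere {k : ℕ} {a b : Fin k → V} (h : IsInducedMatching G T a b) :
    Nonempty ((indOn G T).realization ≃ₜ Metric.sphere (0 : EuclideanSpace ℝ (Fin k)) 1) := by
  obtain ⟨e⟩ := nonempty_sphere_homeomorph
    ((PiLp.continuousLinearEquiv 1 ℝ fun _ : Fin k => ℝ).trans
      (PiLp.continuousLinearEquiv 2 ℝ fun _ : Fin k => ℝ).symm)
  exact ⟨h.realizationHomeomorph.trans e⟩

end IsInducedMatching

/-! ### Independence complexes of forests -/

/-- `S` folds to an induced matching of `k` edges, one end of each of which can be chosen so that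
these ends dominate `S`, and `S` contains `k` vertices with disjoint closed neighbourhoods. So `k`
is at once the size of an independent dominating set and a lower bound for dominating sets. -/
def FoldsToDominatingMatching (G : SimpleGraph V) (S : Finset V) (k : ℕ) : Prop :=
  ∃ (T : Finset V) (a b p : Fin k → V), Folds G S T ∧ IsInducedMatching G T a b ∧
    (∀ x ∈ S, ∃ i, Dominates G (a i) x) ∧ IsPacking G S p

theorem foldsToDominatingMatching_empty : FoldsToDominatingMatching G ∅ 0 :=
  ⟨∅, Fin.elim0, Fin.elim0, Fin.elim0, Relation.ReflTransGen.refl, by constructor <;> simp,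
    by simp, by constructor <;> simp⟩

theorem FoldsToDominatingMatching.of_removeNbhd {S : Finset V} {k : ℕ} {u w : V}
    (h : FoldsToDominatingMatching G (removeNbhd G S w) k) (hu : u ∈ S) (hw : w ∈ S)
    (huw : G.Adj u w) (hul : IsLeafIn G (S : Set V) u)
    (hend : ∀ v ∈ S, G.Adj w v → IsLeafIn G (core G (S : Set V)) v)
    (hiso : ¬ HasIsolated G (removeNbhd G S w)) : FoldsToDominatingMatching G S (k + 1) := by
  obtain ⟨T, a, b, p, hT, hab, hdom, hp⟩ := h
  obtain ⟨p', hp'⟩ := hp.exists_cons hu hw huw hul hend hiso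
  have hR := not_dominates_of_mem_removeNbhd hw huw hul
  refine ⟨{w, u} ∪ T, Fin.cons w a, Fin.cons u b, p', ?_, ?_, fun x hx => ?_, hp'⟩
  · exact (folds_of_isLeafIn hu hw huw hul).trans (hT.union_left hR)
  · exact hab.cons huw fun r hr x hx => hR r hr x (hT.subset hx)
  · by_cases hwx : Dominates G w x
    · exact ⟨0, hwx⟩
    · obtain ⟨i, hi⟩ := hdom x (mem_removeNbhd.2 ⟨hx, hwx⟩)
      exact ⟨i.succ, hi⟩

theorem folds_hasIsolated_or_foldsToDominatingMatching (hG : G.IsAcyclic) (S : Finset V) :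
    (∃ T, Folds G S T ∧ HasIsolated G T) ∨ ∃ k, FoldsToDominatingMatching G S k := by
  induction S using Finset.strongInduction with
  | H S ih =>
    by_cases hisoS : HasIsolated G S
    · exact Or.inl ⟨S, Relation.ReflTransGen.refl, hisoS⟩
    obtain rfl | hne := S.eq_empty_or_nonempty
    · exact Or.inr ⟨0, foldsToDominatingMatching_empty⟩
    obtain ⟨u, hu, w, hw, huw, hul, hend⟩ := exists_end_leaf hG S.finite_toSet hne
      fun x hx => by
        by_contra! h
        exact hisoS ⟨x, hx, h⟩
    have hfold := folds_of_isLeafIn hu hw huw hul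
    have hR := not_dominates_of_mem_removeNbhd hw huw hul
    obtain ⟨T, hT, hTiso⟩ | ⟨k, hk⟩ := ih _ (removeNbhd_ssubset hw)
    · exact Or.inl ⟨_, hfold.trans (hT.union_left hR),
        hTiso.union_left fun r hr x hx => hR r hr x (hT.subset hx)⟩
    by_cases hiso : HasIsolated G (removeNbhd G S w)
    · exact Or.inl ⟨_, hfold, hiso.union_left hR⟩
    · exact Or.inr ⟨k + 1, hk.of_removeNbhd hu hw huw hul hend hiso⟩

namespace FoldsToDominatingMatching

theorem nonempty_homotopyEquiv_sphere {S : Finset V} {k : ℕ}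
    (h : FoldsToDominatingMatching G S k) :
    Nonempty (ContinuousMap.HomotopyEquiv (indOn G S).realization
      (Metric.sphere (0 : EuclideanSpace ℝ (Fin k)) 1)) := by
  obtain ⟨T, a, b, -, hT, hab, -, -⟩ := h
  obtain ⟨e⟩ := hT.nonempty_homotopyEquiv
  obtain ⟨e'⟩ := hab.nonempty_homeomorph_sphere
  exact ⟨e.trans e'.toHomotopyEquiv⟩

variable [Fintype V] {k : ℕ}

theorem le_card (h : FoldsToDominatingMatching G Finset.univ k) {D : Finset V}
    (hD : G.IsDominatingSet (D : Set V)) : k ≤ D.card := by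
  obtain ⟨-, -, -, p, -, -, -, hp⟩ := h
  exact hp.le_card hD

theorem exists_isIndepSet_isDominatingSet (h : FoldsToDominatingMatching G Finset.univ k) :
    ∃ D : Finset V, G.IsIndepSet (D : Set V) ∧ G.IsDominatingSet (D : Set V) ∧ D.card = k := by
  obtain ⟨T, a, b, -, -, hab, hdom, -⟩ := h
  refine ⟨Finset.univ.map ⟨a, hab.left_injective⟩, ?_, isDominatingSet_iff.2 fun x => ?_, by simp⟩
  · simp only [Finset.coe_map, Finset.coe_univ, Set.image_univ]
    rintro - ⟨i, rfl⟩ - ⟨j, rfl⟩ -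
    exact hab.not_adj_left i j
  · simpa using hdom x (Finset.mem_univ x)

theorem domNumber_eq (h : FoldsToDominatingMatching G Finset.univ k) : G.domNumber = k := by
  obtain ⟨D, -, hD, hk⟩ := h.exists_isIndepSet_isDominatingSet
  refine IsLeast.csInf_eq ⟨⟨D, hD, hk⟩, ?_⟩
  rintro - ⟨D', hD', rfl⟩
  exact h.le_card hD'

theorem indepDomNumber_eq (h : FoldsToDominatingMatching G Finset.univ k) :
    G.indepDomNumber = k := by
  obtain ⟨D, hI, hD, hk⟩ := h.exists_isIndepSet_isDominatingSet
  refine IsLeast.csInf_eq ⟨⟨D, hI, hD, hk⟩, ?_⟩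
  rintro - ⟨D', -, hD', rfl⟩
  exact h.le_card hD'

end FoldsToDominatingMatching

end IndependenceComplex

/-- For a finite forest `F`, the complex `Ind(F)` is a grape, and it is contractible or homotopy
equivalent to the sphere of dimension `i(F) - 1 = γ(F) - 1`, i.e. the unit sphere of the Euclidean
space of dimension `i(F) = γ(F)` (empty if that dimension is `0`). -/
theorem theorem4p7 {V : Type*} [Fintype V] [DecidableEq V] (F : SimpleGraph V)
    (hF : F.IsAcyclic) :
    F.indComplex.IsGrape ∧
      (ContractibleSpace F.indComplex.realization ∨
        (F.indepDomNumber = F.domNumber ∧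
          Nonempty (ContinuousMap.HomotopyEquiv F.indComplex.realization
            (Metric.sphere (0 : EuclideanSpace ℝ (Fin F.indepDomNumber)) 1)))) := by
  rw [← IndependenceComplex.indOn_univ]
  refine ⟨IndependenceComplex.isGrape_indOn hF Finset.univ, ?_⟩
  obtain ⟨T, hT, hiso⟩ | ⟨k, hk⟩ :=
    IndependenceComplex.folds_hasIsolated_or_foldsToDominatingMatching hF Finset.univ
  · exact Or.inl (hT.contractibleSpace hiso)
  · rw [hk.indepDomNumber_eq, hk.domNumber_eq]
    exact Or.inr ⟨rfl, hk.nonempty_homotopyEquiv_sphere⟩
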